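/- Let $X$ be a Tychonoff space and let $\lambda$ be a family of subsets of $X$ with $\bigcup\lambda = X$. Let $C_{\lambda,\rho}(X)$ be the set of all continuous functions $X\to\mathbb{R}$ with the topology of uniform convergence on the members of $\lambda$, i.e. the topology of the uniformity generated by the sets $\{(f,g) : |f(x)-g(x)|<\varepsilon \text{ for all } x\in A\}$, $A\in\lambda$, $\varepsilon>0$. A space $D$ is countably pracompact if it has a dense subset $E$ such that every infinite subset of $E$ has an accumulation point in $D$; it is $\sigma$-countably pracompact if it is a union of countably many countably pracompact subspaces. Let $\gamma_c$ be the family of all subspaces of $X$ that have a dense $\sigma$-countably pracompact subset. For a family $\gamma$ of subsets of $X$, a non-closed set $A\subseteq X$ and $x\in\overline{A}\setminus A$, consider the following game: at step $n\in\mathbb{N}$, player ONE chooses a neighborhood $V_n$ of $x$, and then player TWO chooses a set $S_n\subseteq A$ with $S_n\subseteq\overline{T_n}$ for some $T_n\in\gamma$. Player TWO wins if $\overline{\bigcup_n S_n}\cap\bigcap_n V_n\neq\emptyset$; otherwise ONE wins. The space $X$ is an $AV_\gamma$-space if for every non-closed $A\subseteq X$ there is a point $x\in\overline{A}\setminus A$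 for which player TWO has a winning strategy. The space $X$ is functionally generated by $\gamma$ if for every discontinuous $f:X\to\mathbb{R}$ there is $A\in\gamma$ such that $f|_A$ does not extend to a continuous real-valued function on $X$. Suppose that $X$ is an $AV_{\gamma_c}$-space or that $X$ is functionally generated by $\gamma_c$. Then every pseudocompact subset $F$ of $C_{\lambda,\rho}(X)$ (i.e. such that every continuous real-valued function on the subspace $F$ is bounded) has compact closure in $C_{\lambda,\rho}(X)$. -/

import Mathlib

open Set Filter Topology

/-- The space `C_{lam,μ}(X, Y)` of continuous maps `X → Y` with the topology (and uniformity)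
of uniform convergence on the members of `lam`: its uniformity is generated by the sets
`{(f, g) | ∀ x ∈ A, (f x, g x) ∈ M}` with `A ∈ lam` and `M` an entourage of `Y`. -/
abbrev ContUniformOn (X Y : Type*) [TopologicalSpace X] [UniformSpace Y] (lam : Set (Set X)) :
    Type _ :=
  {f : UniformOnFun X Y lam // Continuous (UniformOnFun.toFun lam f)}

/-- `A` is pseudocompact: every continuous real-valued function on the subspace `A` is bounded. -/
def IsPseudocompactSet {Z : Type*} [TopologicalSpace Z] (A : Set Z) : Prop :=
  ∀ g : A → ℝ, Continuous g → ∃ M : ℝ, ∀ z : A, |g z| ≤ M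

/-- `A` is relatively compact: its closure is compact. -/
def IsRelativelyCompactSet {Z : Type*} [TopologicalSpace Z] (A : Set Z) : Prop :=
  IsCompact (closure A)

/-- The subspace `D` is countably pracompact: it has a dense subset `E` such that every infinite
subset of `E` has a limit (accumulation) point in `D`. -/
def IsCountablyPracompactSet {X : Type*} [TopologicalSpace X] (D : Set X) : Prop :=
  ∃ E : Set X, E ⊆ D ∧ D ⊆ closure E ∧
    ∀ B : Set X, B ⊆ E → B.Infinite → ∃ z ∈ D, AccPt z (𝓟 B)

/-- `D` is the union of countably many countably pracompact subspaces. -/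
def IsSigmaCountablyPracompactSet {X : Type*} [TopologicalSpace X] (D : Set X) : Prop :=
  ∃ S : ℕ → Set X, (∀ n, IsCountablyPracompactSet (S n)) ∧ D = ⋃ n, S n

/-- The family `γ_c` of all subspaces of `X` that have a dense σ-countably pracompact subset. -/
def gammaC (X : Type*) [TopologicalSpace X] : Set (Set X) :=
  {A | ∃ D : Set X, D ⊆ A ∧ A ⊆ closure D ∧ IsSigmaCountablyPracompactSet D}

/-- A strategy of player TWO in the Asanov–Velichko game: at step `n` it sees the moves
`V 0, …, V n` made so far by player ONE and returns a set. -/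
def AVStrategy (X : Type*) : Type _ := (n : ℕ) → (Fin (n + 1) → Set X) → Set X

/-- The strategy `s` of player TWO is winning in the Asanov–Velichko game generated by `fam`, on
the set `A` at the point `x`.  At step `n` ONE plays a neighbourhood `V n` of `x`, then TWO plays
a set `S n ⊆ A` which lies in the closure of some member of `fam`; TWO wins if the closure of
`⋃ n, S n` meets `⋂ n, V n`. -/
def AVStrategy.IsWinning {X : Type*} [TopologicalSpace X] (s : AVStrategy X)
    (fam : Set (Set X)) (A : Set X) (x : X) : Prop :=
  ∀ V : ℕ → Set X, (∀ n, V n ∈ 𝓝 x) →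
    (∀ n, s n (fun i => V i) ⊆ A ∧ ∃ T ∈ fam, s n (fun i => V i) ⊆ closure T) ∧
      (closure (⋃ n, s n (fun i => V i)) ∩ ⋂ n, V n).Nonempty

/-- `X` is Asanov–Velichko generated by `fam` (an `AV_fam`-space). -/
def IsAVSpace (X : Type*) [TopologicalSpace X] (fam : Set (Set X)) : Prop :=
  ∀ A : Set X, ¬ IsClosed A →
    ∃ x ∈ closure A \ A, ∃ s : AVStrategy X, s.IsWinning fam A x

/-- `X` is functionally generated by `fam`: for every discontinuous `f : X → ℝ` there is `A ∈ fam`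
such that the restriction of `f` to `A` has no continuous extension to all of `X`. -/
def IsFunctionallyGenerated (X : Type*) [TopologicalSpace X] (fam : Set (Set X)) : Prop :=
  ∀ f : X → ℝ, ¬ Continuous f →
    ∃ A ∈ fam, ¬ ∃ g : X → ℝ, Continuous g ∧ EqOn g f A

/-! A pseudocompact `F` is feebly compact, hence totally bounded, so its closure in the complete
space `UniformOnFun X ℝ lam` is compact. It remains to see that the limits `f` of `F` are
continuous; as `lam` covers `X`, it suffices to treat pointwise limits. The key is
`IsPseudocompactSet.exists_eqOn_of_mem_gammaC`: on each member of `gammaC X`, `f` agrees with a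
member of `F`. Functional generation then gives continuity at once; in an AV-space, such members of
`F` dictate moves of ONE that contradict a winning strategy of TWO. For the key, `F` satisfies
Grothendieck's double limit condition (`double_limit`). With Baire category this yields nonempty
relatively open pieces of `F` with small uniform oscillation on a given `E k`
(`exists_isOpen_subset_abs_sub_le`). A sequence of such pieces, tied to `f` at more and more points,
clusters at the required function (`exists_eqOn_of_bounded`). -/

/-! ### Feeble compactness and reduction to continuity of limits -/

/-- Every sequence of open sets meeting `F` has a cluster point in `F`. -/
def IsFeeblyCompactSet {Z : Type*} [TopologicalSpace Z] (F : Set Z) : Prop :=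
  ∀ U : ℕ → Set Z, (∀ n, IsOpen (U n)) → (∀ n, (U n ∩ F).Nonempty) →
    ∃ g ∈ F, ∀ W ∈ 𝓝 g, ∃ᶠ n in atTop, (W ∩ (U n ∩ F)).Nonempty

theorem IsPseudocompactSet.image {Z Y : Type*} [TopologicalSpace Z] [TopologicalSpace Y]
    {F : Set Z} (hF : IsPseudocompactSet F) {φ : Z → Y} (hφ : Continuous φ) :
    IsPseudocompactSet (φ '' F) := by
  intro g hg
  obtain ⟨M, hM⟩ := hF (fun z => g ⟨φ z, mem_image_of_mem φ z.2⟩)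
    (hg.comp ((hφ.comp continuous_subtype_val).subtype_mk _))
  refine ⟨M, ?_⟩
  rintro ⟨_, z, hz, rfl⟩
  exact hM ⟨z, hz⟩

/-- Without a cluster point, bumps of height `n` supported in `U n` would be locally finite on `F`,
with a continuous unbounded sum. -/
theorem IsPseudocompactSet.isFeeblyCompactSet {Z : Type*} [TopologicalSpace Z]
    [CompletelyRegularSpace Z] {F : Set Z} (hF : IsPseudocompactSet F) :
    IsFeeblyCompactSet F := by
  intro U hU hne
  by_contra! hcon
  choose p hp using hne
  choose φ hφc hφ0 hφ1 using fun n =>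
    CompletelyRegularSpace.completely_regular_isOpen (p n) (U n) (hU n) (hp n).1
  have hsupp : ∀ n z, z ∉ U n → (n : ℝ) * (1 - (φ n z : ℝ)) = 0 := by
    intro n z hz
    have h := hφ1 n hz
    simp [h]
  have hnonneg : ∀ (n : ℕ) z, 0 ≤ (n : ℝ) * (1 - (φ n z : ℝ)) := fun n z =>
    mul_nonneg n.cast_nonneg (sub_nonneg.2 (φ n z).2.2)
  have hlf : LocallyFinite fun n : ℕ =>
      Function.support fun z : F => (n : ℝ) * (1 - (φ n z : ℝ)) := by
    intro z
    obtain ⟨W, hW, hWf⟩ := hcon z z.2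
    rw [eventually_atTop] at hWf
    obtain ⟨N, hN⟩ := hWf
    refine ⟨Subtype.val ⁻¹' W, continuous_subtype_val.continuousAt hW,
      (finite_lt_nat N).subset ?_⟩
    rintro n ⟨w, hw, hwW⟩
    by_contra hn
    have hwU : (w : Z) ∈ U n := by
      by_contra hwU
      exact hw (hsupp n w hwU)
    exact (hN n (not_lt.1 hn)).le ⟨hwW, hwU, w.2⟩
  obtain ⟨M, hM⟩ := hF (fun z => ∑ᶠ n : ℕ, (n : ℝ) * (1 - (φ n z : ℝ)))
    (continuous_finsum (fun n => continuous_const.mul (continuous_const.sub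
      (continuous_subtype_val.comp ((hφc n).comp continuous_subtype_val)))) hlf)
  obtain ⟨n, hn⟩ := exists_nat_gt M
  have h1 := single_le_finsum (f := fun m : ℕ => (m : ℝ) * (1 - (φ m (p n) : ℝ))) n
    (hlf.point_finite ⟨p n, (hp n).2⟩) fun m => hnonneg m (p n)
  have h2 := (le_abs_self _).trans (hM ⟨p n, (hp n).2⟩)
  simp only [hφ0 n] at h1
  simp at h1 h2
  linarith

theorem IsFeeblyCompactSet.totallyBounded {Z : Type*} [UniformSpace Z] {F : Set Z}
    (hF : IsFeeblyCompactSet F) : TotallyBounded F := by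
  intro V hV
  by_contra! hcon
  obtain ⟨V₁, hV₁, hs₁, hV₁V⟩ := comp_symm_mem_uniformity_sets hV
  obtain ⟨V₂, hV₂, hs₂, hV₂V⟩ := comp_symm_mem_uniformity_sets hV₁
  obtain ⟨u, hu⟩ := seq_of_forall_finite_exists
    (P := fun c (t : Set Z) => c ∈ F ∧ ∀ y ∈ t, (c, y) ∉ V) fun t ht => by
      obtain ⟨c, hc, hct⟩ := not_subset.1 (hcon t ht)
      refine ⟨c, hc, fun y hy hcy => hct ?_⟩
      simp only [mem_iUnion]
      exact ⟨y, hy, hcy⟩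
  obtain ⟨g, -, hg⟩ := hF (fun n => interior (UniformSpace.ball (u n) V₂))
    (fun n => isOpen_interior) fun n =>
      ⟨u n, mem_interior_iff_mem_nhds.2 (UniformSpace.ball_mem_nhds _ hV₂), (hu n).1⟩
  have hclose : ∀ n, (UniformSpace.ball g V₂ ∩
      (interior (UniformSpace.ball (u n) V₂) ∩ F)).Nonempty → (u n, g) ∈ V₁ := by
    rintro n ⟨z, hz, hz', -⟩
    have h' : z ∈ UniformSpace.ball (u n) V₂ := interior_subset hz'
    exact hV₂V ⟨z, h', hs₂.symm _ _ hz⟩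
  have hfr := hg _ (UniformSpace.ball_mem_nhds _ hV₂)
  obtain ⟨m, hm⟩ := hfr.exists
  obtain ⟨n, hn, hmn⟩ := (hfr.and_eventually (eventually_gt_atTop m)).exists
  exact (hu n).2 (u m) ⟨m, hmn, rfl⟩
    (hV₁V ⟨g, hclose n hn, hs₁.symm _ _ (hclose m hm)⟩)

theorem exists_mapClusterPt_of_infinite_accPt {X : Type*} [TopologicalSpace X] [T1Space X]
    {E D : Set X} (hED : E ⊆ D)
    (h : ∀ B : Set X, B ⊆ E → B.Infinite → ∃ z ∈ D, AccPt z (𝓟 B))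
    (x : ℕ → X) (hx : ∀ n, x n ∈ E) : ∃ y ∈ D, MapClusterPt y atTop x := by
  by_cases hfin : (range x).Finite
  · have : Finite (range x) := hfin
    obtain ⟨y, hy⟩ := Finite.exists_infinite_fiber (rangeFactorization x)
    obtain ⟨n₀, hn₀⟩ := y.2
    refine ⟨y, hn₀ ▸ hED (hx n₀), mapClusterPt_iff_frequently.2 fun s hs => ?_⟩
    have hinf := Nat.frequently_atTop_iff_infinite.2 (infinite_coe_iff.1 hy)
    refine hinf.mono fun n hn => ?_
    have : x n = y := congrArg Subtype.val hn
    exact this ▸ mem_of_mem_nhds hs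
  · obtain ⟨z, hz, hacc⟩ := h (range x) (range_subset_iff.2 hx) hfin
    refine ⟨z, hz, mapClusterPt_iff_frequently.2 fun s hs => ?_⟩
    rw [Nat.frequently_atTop_iff_infinite]
    intro hsf
    have hinf := Set.Infinite.of_accPt (hacc.nhds_inter hs)
    refine hinf ((hsf.image x).subset ?_)
    rintro _ ⟨h1, n, rfl⟩
    exact ⟨n, h1, rfl⟩

theorem IsPseudocompactSet.isCompact_closure_of_continuous {X : Type*} [TopologicalSpace X]
    (lam : Set (Set X)) (F : Set (ContUniformOn X ℝ lam)) (hF : IsPseudocompactSet F)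
    (h : ∀ f ∈ closure (Subtype.val '' F), Continuous (UniformOnFun.toFun lam f)) :
    IsCompact (closure F) := by
  have h1 : IsFeeblyCompactSet (Subtype.val '' F) :=
    (hF.image continuous_subtype_val).isFeeblyCompactSet
  have h2 : IsCompact (closure (Subtype.val '' F)) :=
    h1.totallyBounded.closure.isCompact_of_isClosed isClosed_closure
  rw [Topology.IsEmbedding.subtypeVal.isCompact_iff]
  convert h2 using 1
  rw [Topology.IsEmbedding.subtypeVal.closure_eq_preimage_closure_image, image_preimage_eq_iff]
  intro f hf
  exact ⟨⟨f, h f hf⟩, rfl⟩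

/-! ### Double limits -/

theorem eq_of_mapClusterPt_of_tendsto {X ι : Type*} [TopologicalSpace X] {l : Filter ι}
    {x : ι → X} {y : X} (hy : MapClusterPt y l x) {φ : X → ℝ} (hφ : Continuous φ) {c : ℝ}
    (hc : Tendsto (fun n => φ (x n)) l (𝓝 c)) : φ y = c := by
  have h : MapClusterPt (φ y) l (φ ∘ x) := hy.continuousAt_comp hφ.continuousAt
  have h' : (𝓝 (φ y) ⊓ 𝓝 c).NeBot := NeBot.mono h (inf_le_inf_left _ hc)
  exact eq_of_nhds_neBot h'

theorem eq_of_frequently_nonempty {Z : Type*} [TopologicalSpace Z] {F : Set Z} {U : ℕ → Set Z}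
    {g : Z} (hg : ∀ W ∈ 𝓝 g, ∃ᶠ n in atTop, (W ∩ (U n ∩ F)).Nonempty) {L : Z → ℝ}
    (hL : Continuous L) {t : ℝ} {r δ : ℕ → ℝ} (hδ : Tendsto δ atTop (𝓝 0))
    (hr : Tendsto r atTop (𝓝 t)) (h : ∀ᶠ n in atTop, ∀ φ ∈ U n ∩ F, |L φ - r n| ≤ δ n) :
    L g = t := by
  refine eq_of_forall_dist_le fun ε hε => ?_
  have hW : {φ : Z | dist (L φ) (L g) < ε / 3} ∈ 𝓝 g :=
    hL.continuousAt (Metric.ball_mem_nhds (L g) (by positivity : 0 < ε / 3))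
  obtain ⟨n, ⟨φ, hφ, hφU⟩, h1, h2, h3⟩ := ((hg _ hW).and_eventually
    ((hδ.eventually_lt_const (by positivity : 0 < ε / 3)).and
      ((hr.eventually (Metric.ball_mem_nhds t (by positivity : 0 < ε / 3))).and h))).exists
  have h4 := h3 φ hφU
  simp only [mem_ofPred_eq, Real.dist_eq, abs_lt] at *
  rw [abs_le] at *
  constructor <;> linarith [hφ.1, hφ.2, h2.1, h2.2, h4.1, h4.2]

theorem abs_sub_self_lt {a ε : ℝ} (hε : 0 < ε) : |a - a| < ε := by simpa using hε

theorem isOpen_setOf_abs_sub_lt {X : Type*} (z : X) (a ε : ℝ) :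
    IsOpen {φ : X → ℝ | |φ z - a| < ε} :=
  isOpen_lt ((continuous_apply z).sub continuous_const).abs continuous_const

/-- Neighbourhoods of `f m` controlling the values at `x 0, …, x m` and `y` cluster at some `g ∈ F`
with `g (x n) = k n` and `g y = α`; continuity of `g` at `y` forces `g y = β`. -/
theorem IsFeeblyCompactSet.double_limit {X : Type*} [TopologicalSpace X] {F : Set (X → ℝ)}
    (hF : IsFeeblyCompactSet F) (hFc : ∀ φ ∈ F, Continuous φ) {x : ℕ → X} {y : X}
    (hy : MapClusterPt y atTop x) {f : ℕ → X → ℝ} (hf : ∀ m, f m ∈ F) {c k : ℕ → ℝ} {α β : ℝ}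
    (hc : ∀ m, Tendsto (fun n => f m (x n)) atTop (𝓝 (c m))) (hα : Tendsto c atTop (𝓝 α))
    (hk : ∀ n, Tendsto (fun m => f m (x n)) atTop (𝓝 (k n))) (hβ : Tendsto k atTop (𝓝 β)) :
    α = β := by
  have hcy : ∀ m, f m y = c m := fun m => eq_of_mapClusterPt_of_tendsto hy (hFc _ (hf m)) (hc m)
  have hpos : ∀ m : ℕ, (0 : ℝ) < 1 / ((m : ℝ) + 1) := fun m => by positivity
  obtain ⟨g, hgF, hg⟩ := hF (fun m =>
      (⋂ n ∈ Iic m, {φ : X → ℝ | |φ (x n) - f m (x n)| < 1 / ((m : ℝ) + 1)}) ∩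
        {φ : X → ℝ | |φ y - f m y| < 1 / ((m : ℝ) + 1)})
    (fun m => ((finite_Iic m).isOpen_biInter fun n _ => isOpen_setOf_abs_sub_lt _ _ _).inter
      (isOpen_setOf_abs_sub_lt _ _ _))
    (fun m => ⟨f m, ⟨mem_iInter₂.2 fun n _ => (abs_sub_self_lt (hpos m)), (abs_sub_self_lt (hpos m))⟩, hf m⟩)
  have hgx : ∀ n, g (x n) = k n := fun n =>
    eq_of_frequently_nonempty hg (continuous_apply _) tendsto_one_div_add_atTop_nhds_zero_nat (hk n) (by
      filter_upwards [eventually_ge_atTop n] with m hm φ hφ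
      exact (mem_iInter₂.1 hφ.1.1 n hm).le)
  have hgα : g y = α :=
    eq_of_frequently_nonempty hg (continuous_apply _) tendsto_one_div_add_atTop_nhds_zero_nat
      (by simpa only [hcy] using hα) (Eventually.of_forall fun m φ hφ => hφ.1.2.le)
  rw [← hgα]
  exact eq_of_mapClusterPt_of_tendsto hy (hFc g hgF) (by simpa only [hgx] using hβ)

/-! ### Small oscillation by Baire category -/

theorem exists_finset_net {X ι : Type*} [Fintype ι] (E : Set X) (φ : ι → X → ℝ) {C : ℝ}
    (hb : ∀ i x, |φ i x| ≤ C) {ε : ℝ} (hε : 0 < ε) :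
    ∃ P : Finset X, ↑P ⊆ E ∧ ∀ e ∈ E, ∃ p ∈ P, ∀ i, |φ i e - φ i p| < ε := by
  classical
  let Φ : X → ι → ℝ := fun x i => φ i x
  have htb : TotallyBounded (Φ '' E) := by
    refine (isCompact_univ_pi fun _ : ι => isCompact_Icc (a := -C) (b := C)).totallyBounded.subset ?_
    rintro _ ⟨x, -, rfl⟩ i -
    exact abs_le.1 (hb i x)
  obtain ⟨t, htE, htf, ht⟩ := exists_subset_image_finite_and.1
    (htb.exists_subset (Metric.dist_mem_uniformity hε))
  refine ⟨htf.toFinset, by simpa using htE, fun e he => ?_⟩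
  obtain ⟨_, ⟨p, hp, rfl⟩, hpe⟩ := mem_iUnion₂.1 (ht (mem_image_of_mem Φ he))
  exact ⟨p, by simpa using hp, fun i => (dist_le_pi_dist _ _ i).trans_lt hpe⟩

/-- Otherwise there are two sequences in `E` along which every `q i` has the same limit `c i`, while
`k` has limits differing by at least `ε`. The double limit condition identifies both with a limit of
`c (m j)`, where `q (m j)` tends to `k`. -/
theorem IsFeeblyCompactSet.exists_modulus {X : Type*} [TopologicalSpace X] {F : Set (X → ℝ)}
    (hF : IsFeeblyCompactSet F) (hFc : ∀ φ ∈ F, Continuous φ) {C : ℝ}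
    (hb : ∀ φ ∈ F, ∀ x, |φ x| ≤ C) {E : Set X}
    (hE : ∀ x : ℕ → X, (∀ n, x n ∈ E) → ∃ y, MapClusterPt y atTop x)
    {q : ℕ → X → ℝ} (hq : ∀ i, q i ∈ F) {P : Set X} [Countable P] {k : P → ℝ}
    (hk : k ∈ closure (range fun i (p : P) => q i p)) {ε : ℝ} (hε : 0 < ε) :
    ∃ n : ℕ, ∀ p p' : P, (p : X) ∈ E → (p' : X) ∈ E →
      (∀ i ≤ n, |q i p - q i p'| ≤ 1 / ((n : ℝ) + 1)) → |k p - k p'| ≤ ε := by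
  by_contra! hcon
  choose p p' hpE hpE' hclose hfar using hcon
  obtain ⟨u, hu, huk⟩ := mem_closure_iff_seq_limit.1 hk
  choose m hm using hu
  have huk' : ∀ z : P, Tendsto (fun j => q (m j) z) atTop (𝓝 (k z)) := fun z => by
    have h := (tendsto_pi_nhds.1 huk) z
    simpa only [← hm] using h
  have hkb : ∀ z, k z ∈ Icc (-C) C := fun z =>
    isClosed_Icc.mem_of_tendsto (huk' z) (Eventually.of_forall fun j => abs_le.1 (hb _ (hq _) _))
  obtain ⟨⟨c, a, a'⟩, -, φ, hφ, hlim⟩ :=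
    ((isCompact_univ_pi fun _ : ℕ => isCompact_Icc (a := -C) (b := C)).prod
      ((isCompact_Icc (a := -C) (b := C)).prod (isCompact_Icc (a := -C) (b := C)))).tendsto_subseq
      (x := fun n => (fun i => q i (p n), k (p n), k (p' n)))
      fun n => ⟨fun i _ => abs_le.1 (hb _ (hq i) _), hkb _, hkb _⟩
  have hc : ∀ i, Tendsto (fun n => q i (p (φ n))) atTop (𝓝 (c i)) := fun i =>
    (tendsto_pi_nhds.1 ((continuous_fst.tendsto _).comp hlim)) i
  have ha : Tendsto (fun n => k (p (φ n))) atTop (𝓝 a) :=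
    ((continuous_fst.comp continuous_snd).tendsto _).comp hlim
  have ha' : Tendsto (fun n => k (p' (φ n))) atTop (𝓝 a') :=
    ((continuous_snd.comp continuous_snd).tendsto _).comp hlim
  have hc' : ∀ i, Tendsto (fun n => q i (p' (φ n))) atTop (𝓝 (c i)) := fun i => by
    have h0 : Tendsto (fun n => q i (p (φ n)) - q i (p' (φ n))) atTop (𝓝 0) := by
      refine squeeze_zero_norm' ?_
        (tendsto_one_div_add_atTop_nhds_zero_nat.comp hφ.tendsto_atTop)
      filter_upwards [hφ.tendsto_atTop.eventually_ge_atTop i] with n hn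
      exact hclose (φ n) i hn
    simpa using (hc i).sub h0
  have hcb : ∀ i, c i ∈ Icc (-C) C := fun i =>
    isClosed_Icc.mem_of_tendsto (hc i) (Eventually.of_forall fun n => abs_le.1 (hb _ (hq _) _))
  obtain ⟨α, -, ψ, hψ, hα⟩ := (isCompact_Icc (a := -C) (b := C)).tendsto_subseq
    (x := fun j => c (m j)) fun j => hcb _
  obtain ⟨y, hy⟩ := hE (fun n => p (φ n)) fun n => hpE _
  obtain ⟨y', hy'⟩ := hE (fun n => p' (φ n)) fun n => hpE' _
  have h1 : α = a := hF.double_limit hFc hy (f := fun j => q (m (ψ j))) (fun j => hq _)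
    (fun j => hc _) hα (fun n => (huk' (p (φ n))).comp hψ.tendsto_atTop) ha
  have h2 : α = a' := hF.double_limit hFc hy' (f := fun j => q (m (ψ j))) (fun j => hq _)
    (fun j => hc' _) hα (fun n => (huk' (p' (φ n))).comp hψ.tendsto_atTop) ha'
  have h3 : Tendsto (fun n => |k (p (φ n)) - k (p' (φ n))|) atTop (𝓝 0) := by
    simpa [← h1, ← h2] using (ha.sub ha').abs
  obtain ⟨n, hn⟩ := (h3.eventually_lt_const hε).exists
  exact (hfar (φ n)).not_gt hn

theorem exists_countable_superset_closed {Z : Type*} (op : Finset Z → Set Z)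
    (hop : ∀ s, (op s).Countable) (z₀ : Z) :
    ∃ C : Set Z, C.Countable ∧ z₀ ∈ C ∧ ∀ s : Finset Z, (s : Set Z) ⊆ C → op s ⊆ C := by
  let step : Set Z → Set Z := fun C => C ∪ ⋃ s ∈ {s : Finset Z | (s : Set Z) ⊆ C}, op s
  have hstep : ∀ C, C.Countable → (step C).Countable := fun C hC =>
    by
    have h : {s : Finset Z | (s : Set Z) ⊆ C}.Countable :=
      ((countable_ofPred_finite_subset hC).preimage
        Finset.coe_injective).mono fun s hs => And.intro s.finite_toSet hs
    exact hC.union (h.biUnion fun s _ => hop s)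
  let A : ℕ → Set Z := fun n => step^[n] {z₀}
  have hsucc : ∀ n, A (n + 1) = step (A n) := fun n => Function.iterate_succ_apply' step n _
  have hmono : Monotone A := monotone_nat_of_le_succ fun n => by
    rw [hsucc]; exact subset_union_left
  refine ⟨⋃ n, A n, countable_iUnion fun n => ?_, mem_iUnion.2 ⟨0, rfl⟩, fun s hs => ?_⟩
  · induction n with
    | zero => exact countable_singleton z₀
    | succ n ih => rw [hsucc]; exact hstep _ ih
  · obtain ⟨n, hn⟩ := hmono.directed_le.exists_mem_subset_of_finset_subset_biUnion hs
    refine subset_trans ?_ (subset_iUnion A (n + 1))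
    rw [hsucc]
    exact subset_union_of_subset_right (subset_biUnion_of_mem (u := op) hn) _

theorem exists_finset_forall_abs_sub_lt {ι : Type*} {f : ι → ℝ} {s : Set (ι → ℝ)}
    (hs : s ∈ 𝓝 f) : ∃ (I : Finset ι) (n : ℕ), ∀ m ≥ n, ∀ k : ι → ℝ,
      (∀ p ∈ I, |k p - f p| < 1 / ((m : ℝ) + 1)) → k ∈ s := by
  rw [nhds_pi, Filter.mem_pi] at hs
  obtain ⟨I, hI, t, ht, hts⟩ := hs
  have h : ∀ᶠ n : ℕ in atTop, ∀ p ∈ hI.toFinset,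
      Metric.ball (f p) (1 / ((n : ℝ) + 1)) ⊆ t p := by
    rw [Filter.eventually_all_finset]
    intro p _
    obtain ⟨ε, hε, hεt⟩ := Metric.mem_nhds_iff.1 (ht p)
    filter_upwards [tendsto_one_div_add_atTop_nhds_zero_nat.eventually_lt_const hε] with n hn
    exact (Metric.ball_subset_ball hn.le).trans hεt
  obtain ⟨n, hn⟩ := eventually_atTop.1 h
  exact ⟨hI.toFinset, n, fun m hm k hk => hts fun p hp =>
    hn m hm p (hI.mem_toFinset.2 hp) (hk p (hI.mem_toFinset.2 hp))⟩

/-- If every piece oscillates by more than `ε`, close off countably many functions and points under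
the choice of witnesses. The moduli of `exists_modulus` cover a compact space by closed sets, so one
modulus works on an open set, where the witnesses cannot differ that much. -/
theorem IsFeeblyCompactSet.exists_isOpen_subset_abs_sub_le {X : Type*} [TopologicalSpace X]
    {F : Set (X → ℝ)} (hF : IsFeeblyCompactSet F) (hFc : ∀ φ ∈ F, Continuous φ) {C : ℝ}
    (hb : ∀ φ ∈ F, ∀ x, |φ x| ≤ C) {E : Set X}
    (hE : ∀ x : ℕ → X, (∀ n, x n ∈ E) → ∃ y, MapClusterPt y atTop x)
    {V : Set (X → ℝ)} (hV : IsOpen V) (hne : (V ∩ F).Nonempty) {ε : ℝ} (hε : 0 < ε) :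
    ∃ V' ⊆ V, IsOpen V' ∧ (V' ∩ F).Nonempty ∧
      ∀ h ∈ V' ∩ F, ∀ h' ∈ V' ∩ F, ∀ e ∈ E, |h e - h' e| ≤ ε := by
  classical
  by_contra! hcon
  have hstep : ∀ (q : ↥(V ∩ F)) (S : Finset X) (n : ℕ), ∃ h h' : ↥(V ∩ F), ∃ e ∈ E,
      (∀ z ∈ S, |h.1 z - q.1 z| < 1 / ((n : ℝ) + 1)) ∧
      (∀ z ∈ S, |h'.1 z - q.1 z| < 1 / ((n : ℝ) + 1)) ∧ ε < |h.1 e - h'.1 e| := by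
    intro q S n
    obtain ⟨h, hh, h', hh', e, he, hlt⟩ := hcon
      (V ∩ ⋂ z ∈ S, {φ : X → ℝ | |φ z - q.1 z| < 1 / ((n : ℝ) + 1)}) inter_subset_left
      (hV.inter (isOpen_biInter_finset fun z _ => isOpen_setOf_abs_sub_lt _ _ _))
      ⟨q.1, ⟨q.2.1, mem_iInter₂.2 fun z _ => abs_sub_self_lt (by positivity)⟩, q.2.2⟩
    exact ⟨⟨h, hh.1.1, hh.2⟩, ⟨h', hh'.1.1, hh'.2⟩, e, he, fun z hz => mem_iInter₂.1 hh.1.2 z hz,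
      fun z hz => mem_iInter₂.1 hh'.1.2 z hz, hlt⟩
  choose H H' e heE hH hH' hlt using hstep
  obtain ⟨q₀, hq₀⟩ := hne
  obtain ⟨A, hA, hq₀A, hAcl⟩ := exists_countable_superset_closed
    (fun s : Finset (↥(V ∩ F) ⊕ X) => ⋃ b ∈ s.toLeft, ⋃ n : ℕ,
      {Sum.inl (H b s.toRight n), Sum.inl (H' b s.toRight n), Sum.inr (e b s.toRight n)})
    (fun s => s.toLeft.countable_toSet.biUnion fun b _ => countable_iUnion fun n =>
      Set.Finite.countable (by simp)) (Sum.inl ⟨q₀, hq₀⟩)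
  obtain ⟨q, hq⟩ := (hA.preimage Sum.inl_injective).exists_eq_range ⟨_, hq₀A⟩
  let P : Set X := Sum.inr ⁻¹' A
  have hP : Countable P := (hA.preimage Sum.inr_injective).to_subtype
  have hclosed : ∀ (i : ℕ) (S : Finset X) (n : ℕ), (S : Set X) ⊆ P →
      H (q i) S n ∈ range q ∧ H' (q i) S n ∈ range q ∧ e (q i) S n ∈ P := by
    intro i S n hS
    have hqi : Sum.inl (q i) ∈ A := by
      have : q i ∈ range q := mem_range_self i
      rwa [← hq] at this
    have h := hAcl (Finset.disjSum {q i} S) (by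
      intro z hz
      rcases Finset.mem_disjSum.1 hz with ⟨b, hb, rfl⟩ | ⟨x, hx, rfl⟩
      · rwa [Finset.mem_singleton.1 hb]
      · exact hS hx)
    simp only [Finset.toLeft_disjSum, Finset.toRight_disjSum, Finset.mem_singleton,
      iUnion_iUnion_eq_left] at h
    have h' := (subset_iUnion _ n).trans h
    rw [← hq]
    exact ⟨h' (by simp), h' (by simp), h' (by simp)⟩
  let R : ℕ → P → ℝ := fun i p => (q i).1 p
  let K : Set (P → ℝ) := closure (range R)
  have hK : IsCompact K := by
    refine (isCompact_univ_pi fun _ : P => isCompact_Icc (a := -C) (b := C)).closure_of_subset ?_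
    rintro _ ⟨i, rfl⟩ p -
    exact abs_le.1 (hb _ (q i).2.2 _)
  have : CompactSpace K := isCompact_iff_compactSpace.1 hK
  have : Nonempty K := ⟨⟨R 0, subset_closure (mem_range_self 0)⟩⟩
  let G : ℕ → Set (P → ℝ) := fun n => {k | ∀ p p' : P, (p : X) ∈ E → (p' : X) ∈ E →
      (∀ i ≤ n, |(q i).1 p - (q i).1 p'| ≤ 1 / ((n : ℝ) + 1)) → |k p - k p'| ≤ ε / 8}
  have hG : ∀ n, IsClosed (G n) := fun n => by
    simp only [G, ofPred_forall]
    exact isClosed_iInter fun p => isClosed_iInter fun p' => isClosed_iInter fun _ =>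
      isClosed_iInter fun _ => isClosed_iInter fun _ => isClosed_le
        ((continuous_apply p).sub (continuous_apply p')).abs continuous_const
  obtain ⟨n, ⟨k, hkK⟩, hk⟩ := nonempty_interior_of_iUnion_of_closed
    (f := fun n => (Subtype.val ⁻¹' G n : Set K))
    (fun n => (hG n).preimage continuous_subtype_val) (eq_univ_of_forall fun k =>
      mem_iUnion.2 (hF.exists_modulus hFc hb hE (fun i => (q i).2.2) k.2
        (by positivity : 0 < ε / 8)))
  rw [mem_interior_iff_mem_nhds, nhds_subtype_eq_comap, mem_comap] at hk
  obtain ⟨O, hO, hOG⟩ := hk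
  obtain ⟨O', hO'O, hO', hkO'⟩ := mem_nhds_iff.1 hO
  obtain ⟨_, hiO, i, rfl⟩ := mem_closure_iff.1 hkK O' hO' hkO'
  obtain ⟨N, hNE, hN⟩ := exists_finset_net (P ∩ E) (fun j : Fin (n + 1) => (q j).1)
    (fun j x => hb _ (q j).2.2 x) (by positivity : (0 : ℝ) < 1 / ((n : ℝ) + 1))
  obtain ⟨I, m₀, hI⟩ := exists_finset_forall_abs_sub_lt (hO'.mem_nhds hiO)
  obtain ⟨m, hm, hmm₀⟩ := ((tendsto_one_div_add_atTop_nhds_zero_nat.eventually_lt_const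
    (by positivity : 0 < ε / 8)).and (eventually_ge_atTop m₀)).exists
  -- The points of `I` force both witnesses into `G n`; those of `N` make them close to `q i` on the
  -- net. Four errors of `ε / 8` then bound their difference at `e`.
  let S : Finset X := I.map (Function.Embedding.subtype _) ∪ N
  have hSP : (S : Set X) ⊆ P := by
    intro z hz
    rcases Finset.mem_union.1 hz with hz | hz
    · obtain ⟨p, -, rfl⟩ := Finset.mem_map.1 hz
      exact p.2
    · exact (hNE hz).1
  obtain ⟨⟨a, ha⟩, ⟨b, hb'⟩, heP⟩ := hclosed i S m hSP
  have hmem : ∀ a, (∀ z ∈ S, |(q a).1 z - (q i).1 z| < 1 / ((m : ℝ) + 1)) → R a ∈ G n := by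
    intro a ha
    refine hOG (a := ⟨R a, subset_closure (mem_range_self a)⟩) (hO'O (hI m hmm₀ _ fun p hp => ?_))
    exact ha p (Finset.mem_union_left _ (Finset.mem_map_of_mem _ hp))
  have h1 := hH (q i) S m
  have h2 := hH' (q i) S m
  have h3 := hlt (q i) S m
  have heE' := heE (q i) S m
  obtain ⟨p, hpN, hp⟩ := hN _ ⟨heP, heE'⟩
  have hmod : ∀ a, R a ∈ G n → |(q a).1 (e (q i) S m) - (q a).1 p| ≤ ε / 8 := fun a ha =>
    ha ⟨_, heP⟩ ⟨p, (hNE hpN).1⟩ heE' (hNE hpN).2 fun j hj => (hp ⟨j, Nat.lt_succ_of_le hj⟩).le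
  rw [← ha] at h1 h3
  rw [← hb'] at h2 h3
  have h4 := hmod a (hmem a h1)
  have h5 := hmod b (hmem b h2)
  have h6 := (h1 p (Finset.mem_union_right _ hpN)).trans hm
  have h7 := (h2 p (Finset.mem_union_right _ hpN)).trans hm
  refine h3.not_ge ?_
  rw [abs_le] at *
  rw [abs_lt] at h6 h7
  constructor <;> linarith [h4.1, h4.2, h5.1, h5.2, h6.1, h6.2, h7.1, h7.2]

theorem IsFeeblyCompactSet.exists_isOpen_subset_forall_abs_sub_le {X : Type*}
    [TopologicalSpace X] {F : Set (X → ℝ)} (hF : IsFeeblyCompactSet F)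
    (hFc : ∀ φ ∈ F, Continuous φ) {C : ℝ} (hb : ∀ φ ∈ F, ∀ x, |φ x| ≤ C) {E : ℕ → Set X}
    (hE : ∀ k, ∀ x : ℕ → X, (∀ n, x n ∈ E k) → ∃ y, MapClusterPt y atTop x)
    {V : Set (X → ℝ)} (hV : IsOpen V) (hne : (V ∩ F).Nonempty) {ε : ℝ} (hε : 0 < ε) (n : ℕ) :
    ∃ V' ⊆ V, IsOpen V' ∧ (V' ∩ F).Nonempty ∧
      ∀ k < n, ∀ h ∈ V' ∩ F, ∀ h' ∈ V' ∩ F, ∀ e ∈ E k, |h e - h' e| ≤ ε := by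
  induction n with
  | zero => exact ⟨V, Subset.rfl, hV, hne, fun k hk => absurd hk k.not_lt_zero⟩
  | succ n ih =>
    obtain ⟨V₁, hV₁V, hV₁, hne₁, h₁⟩ := ih
    obtain ⟨V₂, hV₂V, hV₂, hne₂, h₂⟩ :=
      hF.exists_isOpen_subset_abs_sub_le hFc hb (hE n) hV₁ hne₁ hε
    refine ⟨V₂, hV₂V.trans hV₁V, hV₂, hne₂, fun k hk h hh h' hh' => ?_⟩
    rcases Nat.lt_succ_iff_lt_or_eq.1 hk with hk | rfl
    · exact h₁ k hk h ⟨hV₂V hh.1, hh.2⟩ h' ⟨hV₂V hh'.1, hh'.2⟩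
    · exact h₂ h hh h' hh'

/-! ### Agreement of limits with members of `F` -/

theorem abs_le_of_mem_closure {X : Type*} {F : Set (X → ℝ)} {C : ℝ}
    (hb : ∀ φ ∈ F, ∀ x, |φ x| ≤ C) {f : X → ℝ} (hf : f ∈ closure F) (x : X) : |f x| ≤ C :=
  closure_minimal (fun φ hφ => hb φ hφ x : F ⊆ {φ | |φ x| ≤ C})
    (isClosed_le (continuous_apply x).abs continuous_const) hf

/-- One round of a recursion: `Φ` and `P` are the functions and points gathered so far. -/
theorem IsFeeblyCompactSet.exists_approximation_step {X : Type*} [TopologicalSpace X]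
    {F : Set (X → ℝ)} (hF : IsFeeblyCompactSet F) (hFc : ∀ φ ∈ F, Continuous φ) {C : ℝ}
    (hb : ∀ φ ∈ F, ∀ x, |φ x| ≤ C) {E : ℕ → Set X}
    (hE : ∀ k, ∀ x : ℕ → X, (∀ n, x n ∈ E k) → ∃ y, MapClusterPt y atTop x)
    {f : X → ℝ} (hf : f ∈ closure F) (n : ℕ) (Φ : Finset F) (P : Finset X) :
    ∃ (P' : Finset X) (U : Set (X → ℝ)) (u : F), P ⊆ P' ∧ IsOpen U ∧ u.1 ∈ U ∧
      (∀ k ≤ n, ∀ e ∈ E k, ∃ p ∈ P', p ∈ E k ∧ |f e - f p| ≤ 1 / ((n : ℝ) + 1) ∧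
        ∀ ψ ∈ Φ, |ψ.1 e - ψ.1 p| ≤ 1 / ((n : ℝ) + 1)) ∧
      (∀ h ∈ U ∩ F, ∀ p ∈ P', |h p - f p| ≤ 1 / ((n : ℝ) + 1)) ∧
      (∀ k ≤ n, ∀ h ∈ U ∩ F, ∀ h' ∈ U ∩ F, ∀ e ∈ E k, |h e - h' e| ≤ 1 / ((n : ℝ) + 1)) := by
  classical
  have hpos : (0 : ℝ) < 1 / ((n : ℝ) + 1) := by positivity
  choose N hNE hN using fun k => exists_finset_net (E k)
    (fun i : Option Φ => i.elim f fun ψ => ψ.1.1) (C := C) (by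
      rintro (_ | ψ) x
      · exact abs_le_of_mem_closure hb hf x
      · exact hb _ ψ.1.2 x) hpos
  let P' : Finset X := P ∪ (Finset.range (n + 1)).biUnion N
  have hV : IsOpen (⋂ p ∈ P', {φ : X → ℝ | |φ p - f p| < 1 / ((n : ℝ) + 1)}) :=
    isOpen_biInter_finset fun p _ => isOpen_setOf_abs_sub_lt _ _ _
  obtain ⟨U, hUV, hU, ⟨u, huU, huF⟩, hd⟩ :=
    hF.exists_isOpen_subset_forall_abs_sub_le hFc hb hE hV
      (mem_closure_iff.1 hf _ hV (mem_iInter₂.2 fun p _ => abs_sub_self_lt hpos)) hpos (n + 1)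
  refine ⟨P', U, ⟨u, huF⟩, Finset.subset_union_left, hU, huU, fun k hk e he => ?_,
    fun h hh p hp => (mem_iInter₂.1 (hUV hh.1) p hp).le, fun k hk => hd k (Nat.lt_succ_of_le hk)⟩
  obtain ⟨p, hp, hpe⟩ := hN k e he
  exact ⟨p, Finset.mem_union_right _ (Finset.mem_biUnion.2
    ⟨k, Finset.mem_range.2 (Nat.lt_succ_of_le hk), hp⟩), hNE k hp, (hpe none).le,
    fun ψ hψ => (hpe (some ⟨ψ, hψ⟩)).le⟩

theorem IsFeeblyCompactSet.exists_eqOn_of_bounded {X : Type*} [TopologicalSpace X]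
    {F : Set (X → ℝ)} (hF : IsFeeblyCompactSet F) (hFc : ∀ φ ∈ F, Continuous φ) {C : ℝ}
    (hb : ∀ φ ∈ F, ∀ x, |φ x| ≤ C) {E : ℕ → Set X}
    (hE : ∀ k, ∀ x : ℕ → X, (∀ n, x n ∈ E k) → ∃ y, MapClusterPt y atTop x)
    {f : X → ℝ} (hf : f ∈ closure F) : ∃ g ∈ F, ∀ k, EqOn g f (E k) := by
  classical
  choose P' U' u' hPP' hU' hu'U' hnet hclose hdiam using
    hF.exists_approximation_step hFc hb hE hf
  let st : ℕ → Finset F × Finset X := fun n =>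
    Nat.rec (∅, ∅) (fun n s => (insert (u' n s.1 s.2) s.1, P' n s.1 s.2)) n
  let u : ℕ → F := fun n => u' n (st n).1 (st n).2
  let Q : ℕ → Finset X := fun n => P' n (st n).1 (st n).2
  have hQ : Monotone Q := monotone_nat_of_le_succ fun n => hPP' (n + 1) _ (Q n)
  have hst : Monotone fun n => (st n).1 :=
    monotone_nat_of_le_succ fun n => Finset.subset_insert (u n) _
  have hu : ∀ m n, m < n → u m ∈ (st n).1 := fun m n hmn =>
    hst (Nat.succ_le_of_lt hmn) (Finset.mem_insert_self _ _)
  obtain ⟨g, hgF, hg⟩ := hF (fun n => U' n (st n).1 (st n).2) (fun n => hU' _ _ _)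
    fun n => ⟨u n, hu'U' _ _ _, (u n).2⟩
  have hδ := tendsto_one_div_add_atTop_nhds_zero_nat (𝕜 := ℝ)
  have hgQ : ∀ n, ∀ p ∈ Q n, g p = f p := fun n p hp =>
    eq_of_frequently_nonempty hg (continuous_apply p) hδ tendsto_const_nhds (by
      filter_upwards [eventually_ge_atTop n] with m hm φ hφ
      exact hclose m _ _ φ hφ p (hQ hm hp))
  refine ⟨g, hgF, fun k e he => ?_⟩
  choose x hxQ hxE hxf hxu using fun n =>
    hnet (k + n) (st (k + n)).1 (st (k + n)).2 k (Nat.le_add_right k n) e he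
  have hδ' : Tendsto (fun n : ℕ => 1 / (((k + n : ℕ) : ℝ) + 1)) atTop (𝓝 0) :=
    hδ.comp (tendsto_atTop_mono (fun n => Nat.le_add_left n k) tendsto_id)
  have hlim : ∀ φ : X → ℝ, (∀ᶠ n : ℕ in atTop, |φ e - φ (x n)| ≤ 1 / (((k + n : ℕ) : ℝ) + 1)) →
      Tendsto (fun n => φ (x n)) atTop (𝓝 (φ e)) := fun φ hφ => by
    rw [tendsto_iff_dist_tendsto_zero]
    refine squeeze_zero' (Eventually.of_forall fun n => dist_nonneg) ?_ hδ'
    filter_upwards [hφ] with n hn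
    rwa [dist_comm]
  obtain ⟨y, hy⟩ := hE k x hxE
  have huy : ∀ m, (u m).1 y = (u m).1 e := fun m =>
    eq_of_mapClusterPt_of_tendsto hy (hFc _ (u m).2) (hlim _ (by
      filter_upwards [eventually_gt_atTop m] with n hn
      exact hxu n (u m) (hu m _ (hn.trans_le (Nat.le_add_left n k)))))
  have hgy : g y = f e := eq_of_mapClusterPt_of_tendsto hy (hFc g hgF) (by
    simpa only [fun n => hgQ _ _ (hxQ n)] using hlim f (Eventually.of_forall hxf))
  -- The point `y` may lie outside `E k`; the oscillation bound reaches it by continuity, and `u m`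
  -- does not distinguish `e` from `y`.
  have hge : g e - g y = 0 :=
    eq_of_frequently_nonempty hg ((continuous_apply e).sub (continuous_apply y))
      (show Tendsto (fun m : ℕ => 1 / ((m : ℝ) + 1) + 1 / ((m : ℝ) + 1)) atTop (𝓝 0) by
        simpa using hδ.add hδ) (tendsto_const_nhds (x := (0 : ℝ))) (by
      filter_upwards [eventually_ge_atTop k] with m hm φ hφ
      have h1 := hdiam m _ _ k hm φ hφ (u m) ⟨hu'U' _ _ _, (u m).2⟩
      have h2 : |φ y - (u m).1 y| ≤ 1 / ((m : ℝ) + 1) :=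
        (isClosed_le ((hFc φ hφ.2).sub (hFc _ (u m).2)).abs continuous_const).mem_of_mapClusterPt
          hy (Eventually.of_forall fun n => h1 _ (hxE n))
      have h3 := h1 e he
      rw [huy m] at h2
      change |φ e - φ y - 0| ≤ _
      rw [abs_le] at *
      constructor <;> linarith [h2.1, h2.2, h3.1, h3.2])
  linarith

/-- Composing with the injective `arctan` makes the family uniformly bounded. -/
theorem IsPseudocompactSet.exists_eqOn {X : Type*} [TopologicalSpace X] {F : Set (X → ℝ)}
    (hF : IsPseudocompactSet F) (hFc : ∀ φ ∈ F, Continuous φ) {E : ℕ → Set X}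
    (hE : ∀ k, ∀ x : ℕ → X, (∀ n, x n ∈ E k) → ∃ y, MapClusterPt y atTop x)
    {f : X → ℝ} (hf : f ∈ closure F) : ∃ g ∈ F, ∀ k, EqOn g f (E k) := by
  let T : (X → ℝ) → X → ℝ := fun φ x => Real.arctan (φ x)
  have hT : Continuous T :=
    continuous_pi fun x => Real.continuous_arctan.comp (continuous_apply x)
  obtain ⟨_, ⟨g, hg, rfl⟩, h⟩ := (hF.image hT).isFeeblyCompactSet.exists_eqOn_of_bounded
    (C := Real.pi / 2) (by
      rintro _ ⟨φ, hφ, rfl⟩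
      exact Real.continuous_arctan.comp (hFc φ hφ)) (by
      rintro _ ⟨φ, hφ, rfl⟩ x
      exact abs_le.2 ⟨(Real.neg_pi_div_two_lt_arctan _).le, (Real.arctan_lt_pi_div_two _).le⟩)
    hE (image_closure_subset_closure_image hT (mem_image_of_mem T hf))
  exact ⟨g, hg, fun k e he => Real.arctan_injective (h k he)⟩

theorem IsPseudocompactSet.isCompact_closure_pi {X : Type*} {F : Set (X → ℝ)}
    (hF : IsPseudocompactSet F) : IsCompact (closure F) := by
  choose M hM using fun x : X =>
    hF (fun φ => φ.1 x) ((continuous_apply x).comp continuous_subtype_val)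
  refine (isCompact_univ_pi fun x => isCompact_Icc (a := -M x) (b := M x)).closure_of_subset ?_
  exact fun φ hφ x _ => abs_le.1 (hM x ⟨φ, hφ⟩)

/-! ### The family `gammaC` -/

theorem singleton_mem_gammaC {X : Type*} [TopologicalSpace X] (x : X) : {x} ∈ gammaC X := by
  refine ⟨{x}, Subset.rfl, subset_closure, fun _ => {x}, fun _ => ?_, (iUnion_const _).symm⟩
  exact ⟨{x}, Subset.rfl, subset_closure, fun B hB hinf =>
    (hinf ((finite_singleton x).subset hB)).elim⟩

theorem closure_iUnion_mem_gammaC {X : Type*} [TopologicalSpace X] {T : ℕ → Set X}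
    (hT : ∀ n, T n ∈ gammaC X) : closure (⋃ n, T n) ∈ gammaC X := by
  choose D hDT hTD S hS hD using hT
  refine ⟨⋃ n, D n, (iUnion_mono hDT).trans subset_closure,
    closure_minimal (iUnion_subset fun n => (hTD n).trans (closure_mono (subset_iUnion D n)))
      isClosed_closure, fun j => S j.unpair.1 j.unpair.2, fun j => hS _ _, ?_⟩
  simp only [hD]
  exact (iUnion_unpair S).symm

theorem exists_dense_iUnion_of_mem_gammaC {X : Type*} [TopologicalSpace X] [T1Space X]
    {A : Set X} (hA : A ∈ gammaC X) : ∃ E : ℕ → Set X, A ⊆ closure (⋃ k, E k) ∧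
      ∀ k, ∀ x : ℕ → X, (∀ n, x n ∈ E k) → ∃ y, MapClusterPt y atTop x := by
  obtain ⟨D, -, hAD, S, hS, rfl⟩ := hA
  choose E hES hSE hacc using hS
  refine ⟨E, hAD.trans (closure_minimal (iUnion_subset fun k =>
    (hSE k).trans (closure_mono (subset_iUnion E k))) isClosed_closure), fun k x hx => ?_⟩
  obtain ⟨y, -, hy⟩ := exists_mapClusterPt_of_infinite_accPt (hES k) (hacc k) x hx
  exact ⟨y, hy⟩

theorem IsPseudocompactSet.exists_eqOn_of_mem_gammaC {X : Type*} [TopologicalSpace X] [T1Space X]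
    {F : Set (X → ℝ)} (hF : IsPseudocompactSet F) (hFc : ∀ φ ∈ F, Continuous φ) {A : Set X}
    (hA : A ∈ gammaC X) {f : X → ℝ} (hf : f ∈ closure F) : ∃ g ∈ F, EqOn g f A := by
  obtain ⟨E, hAE, hE⟩ := exists_dense_iUnion_of_mem_gammaC hA
  obtain ⟨g, hg, hgE⟩ := hF.exists_eqOn hFc hE hf
  refine ⟨g, hg, fun a ha => ?_⟩
  -- Adjoining `{a}` to the sequence gives `g'` correct at `a`; it equals `g` on `⋃ k, E k`, hence
  -- at `a` by continuity.
  obtain ⟨g', hg', hgE'⟩ := hF.exists_eqOn hFc (E := fun k => Nat.casesOn k {a} E) (by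
    rintro (_ | k) x hx
    · refine ⟨a, ?_⟩
      have : x = fun _ => a := funext hx
      rw [this]
      exact tendsto_const_nhds.mapClusterPt
    · exact hE k x hx) hf
  have heq : EqOn g g' (⋃ k, E k) := by
    intro z hz
    obtain ⟨k, hk⟩ := mem_iUnion.1 hz
    exact (hgE k hk).trans (hgE' (k + 1) hk).symm
  exact (heq.closure (hFc g hg) (hFc g' hg') (hAE ha)).trans (hgE' 0 rfl)

/-! ### The Asanov–Velichko game and the conclusion -/

theorem exists_seq_eq_of_truncation {α : Type*} (a : α) (Ω : ℕ → (ℕ → α) → α) :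
    ∃ V : ℕ → α, ∀ n, V n = Ω n fun i => if i < n then V i else a := by
  let V : ℕ → α := fun n => Nat.strongRecOn n fun n ih =>
    Ω n fun i => if h : i < n then ih i h else a
  refine ⟨V, fun n => ?_⟩
  have h := Nat.strongRecOn_eq (motive := fun _ => α)
    (fun n ih => Ω n fun i => if h : i < n then ih i h else a) n
  refine h.trans (congrArg (Ω n) (funext fun i => ?_))
  split_ifs <;> rfl

theorem IsPseudocompactSet.continuous_of_isAVSpace {X : Type*} [TopologicalSpace X] [T1Space X]
    (hX : IsAVSpace X (gammaC X)) {F : Set (X → ℝ)} (hF : IsPseudocompactSet F)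
    (hFc : ∀ φ ∈ F, Continuous φ) {f : X → ℝ} (hf : f ∈ closure F) : Continuous f := by
  rw [continuous_iff_isClosed]
  intro C hC
  by_contra hA
  obtain ⟨x, ⟨-, hxA⟩, s, hs⟩ := hX _ hA
  -- `T` must be defined before the moves are known to be legal; illegal ones get `{x}`.
  have hT : ∀ n (w : Fin (n + 1) → Set X), ∃ T ∈ gammaC X,
      (∀ i, w i ∈ 𝓝 x) → s n w ⊆ closure T := by
    intro n w
    by_cases hw : ∀ i, w i ∈ 𝓝 x
    · obtain ⟨T, hT, hsT⟩ := ((hs (fun k => if h : k < n + 1 then w ⟨k, h⟩ else univ) (by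
        intro k
        split_ifs
        · exact hw _
        · exact univ_mem)).1 n).2
      have hw' : (fun i : Fin (n + 1) => if h : (i : ℕ) < n + 1 then w ⟨i, h⟩ else univ) = w :=
        funext fun i => dif_pos i.2
      rw [hw'] at hsT
      exact ⟨T, hT, fun _ => hsT⟩
    · exact ⟨{x}, singleton_mem_gammaC x, fun h => (hw h).elim⟩
  choose T hTγ hsT using hT
  have hG : ∀ n (W : ℕ → Set X), ∃ g ∈ F, g x = f x ∧
      ∀ i < n, EqOn g f (T i fun j => W j) := by
    intro n W
    -- Padding with `{x}` also puts `x` in the union, whence `g x = f x`.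
    have hγ : closure (⋃ i, if i < n then T i (fun j => W j) else {x}) ∈ gammaC X :=
      closure_iUnion_mem_gammaC fun i => by
        split_ifs
        · exact hTγ _ _
        · exact singleton_mem_gammaC x
    obtain ⟨g, hg, hgf⟩ := hF.exists_eqOn_of_mem_gammaC hFc hγ hf
    refine ⟨g, hg, hgf (subset_closure (mem_iUnion.2 ⟨n, by simp⟩)), fun i hi z hz =>
      hgf (subset_closure (mem_iUnion.2 ⟨i, by simpa [hi] using hz⟩))⟩
  choose G hGF hGx hGT using hG
  -- ONE plays where `g n`, which agrees with `f` at `x` and on TWO's earlier sets `T i`, is close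
  -- to `f x`.
  obtain ⟨V, hV⟩ := exists_seq_eq_of_truncation univ fun n W =>
    {z | |G n W z - f x| < 1 / ((n : ℝ) + 1)}
  let g : ℕ → X → ℝ := fun n => G n fun i => if i < n then V i else univ
  let B : ℕ → Set X := fun i => T i fun j => V j
  have hgB : ∀ i n, i < n → EqOn (g n) f (B i) := by
    intro i n hin
    have h := hGT n (fun i => if i < n then V i else univ) i hin
    have h' : (fun j : Fin (i + 1) => if (j : ℕ) < n then V j else univ) =
        fun j : Fin (i + 1) => V j :=
      funext fun j => if_pos (by omega)
    rwa [h'] at h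
  have hVx : ∀ n, V n ∈ 𝓝 x := fun n => by
    rw [hV n]
    refine (isOpen_lt ((hFc _ (hGF _ _)).sub continuous_const).abs continuous_const).mem_nhds ?_
    change |G n _ x - f x| < _
    rw [hGx]
    exact abs_sub_self_lt (by positivity)
  obtain ⟨hS, y, hyS, hyV⟩ := hs V hVx
  have hBγ : closure (⋃ n, B n) ∈ gammaC X := closure_iUnion_mem_gammaC fun n => hTγ _ _
  have hSB : (⋃ n, s n fun i => V i) ⊆ closure (⋃ n, B n) := iUnion_subset fun n =>
    (hsT n _ fun i => hVx i).trans (closure_mono (subset_iUnion B n))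
  have hyB : y ∈ closure (⋃ n, B n) := closure_minimal hSB isClosed_closure hyS
  obtain ⟨p, hpF, hp⟩ := hF.exists_eqOn_of_mem_gammaC hFc hBγ hf
  have hpy : p y ∈ C := closure_minimal (s := ⋃ n, s n fun i => V i) (t := p ⁻¹' C) (by
    intro z hz
    obtain ⟨n, hn⟩ := mem_iUnion.1 hz
    change p z ∈ C
    rw [hp (hSB hz)]
    exact (hS n).1 hn) (hC.preimage (hFc p hpF)) hyS
  obtain ⟨h, hhF, hh⟩ := hF.isCompact_closure_pi.exists_mapClusterPt (u := g) (f := atTop)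
    (tendsto_principal.2 (Eventually.of_forall fun n => subset_closure (hGF _ _)))
  have hhy : h y = f x := eq_of_mapClusterPt_of_tendsto hh (continuous_apply y) (by
    rw [tendsto_iff_dist_tendsto_zero]
    refine squeeze_zero (fun n => dist_nonneg) (fun n => ?_)
      tendsto_one_div_add_atTop_nhds_zero_nat
    have := mem_iInter.1 hyV n
    rw [hV n] at this
    exact le_of_lt this)
  have hhB : EqOn h f (⋃ n, B n) := by
    intro z hz
    obtain ⟨i, hi⟩ := mem_iUnion.1 hz
    refine eq_of_mapClusterPt_of_tendsto hh (continuous_apply z) (tendsto_const_nhds.congr' ?_)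
    filter_upwards [eventually_gt_atTop i] with n hn
    exact (hgB i n hn hi).symm
  -- The cluster point `h` need not be continuous, so `p' ∈ F` replaces it when comparing with `p`
  -- at `y`.
  obtain ⟨p', hp'F, hp'⟩ := hF.exists_eqOn_of_mem_gammaC hFc hBγ hhF
  have hpp' : EqOn p p' (⋃ n, B n) := fun z hz =>
    (hp (subset_closure hz)).trans ((hhB hz).symm.trans (hp' (subset_closure hz)).symm)
  have hpx : p y = f x :=
    (hpp'.closure (hFc p hpF) (hFc p' hp'F) hyB).trans ((hp' hyB).trans hhy)
  exact hxA (hpx ▸ hpy : f x ∈ C)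

theorem IsPseudocompactSet.continuous_of_isFunctionallyGenerated {X : Type*} [TopologicalSpace X]
    [T1Space X] (hX : IsFunctionallyGenerated X (gammaC X)) {F : Set (X → ℝ)}
    (hF : IsPseudocompactSet F) (hFc : ∀ φ ∈ F, Continuous φ) {f : X → ℝ}
    (hf : f ∈ closure F) : Continuous f := by
  by_contra hcon
  obtain ⟨A, hA, hfA⟩ := hX f hcon
  obtain ⟨g, hg, hgf⟩ := hF.exists_eqOn_of_mem_gammaC hFc hA hf
  exact hfA ⟨g, hFc g hg, hgf⟩

theorem mainTheorem8 {X : Type*} [TopologicalSpace X] [T35Space X]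
    (lam : Set (Set X)) (hlam : ⋃₀ lam = univ)
    (hX : IsAVSpace X (gammaC X) ∨ IsFunctionallyGenerated X (gammaC X))
    (F : Set (ContUniformOn X ℝ lam)) (hF : IsPseudocompactSet F) :
    IsRelativelyCompactSet F := by
  refine hF.isCompact_closure_of_continuous lam F fun f hf => ?_
  have hev : Continuous (UniformOnFun.toFun lam : UniformOnFun X ℝ lam → X → ℝ) :=
    (UniformOnFun.uniformContinuous_toFun hlam).continuous
  have hpc : IsPseudocompactSet (UniformOnFun.toFun lam '' (Subtype.val '' F)) :=
    (hF.image continuous_subtype_val).image hev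
  have hc : ∀ φ ∈ UniformOnFun.toFun lam '' (Subtype.val '' F), Continuous φ := by
    rintro _ ⟨_, ⟨φ, -, rfl⟩, rfl⟩
    exact φ.2
  have hcl := image_closure_subset_closure_image hev (mem_image_of_mem _ hf)
  rcases hX with hX | hX
  · exact hpc.continuous_of_isAVSpace hX hc hcl
  · exact hpc.continuous_of_isFunctionallyGenerated hX hc hcl
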